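/- Let $G=\langle V,E,w\rangle$ be a finite directed social network with $n=|V|\ge 1$ vertices, under either the Linear Threshold (LT) model or the Independent Cascade (IC) model, and let $I(S)$ be the influence spread of $S\subseteq V$, that is, the expected number of finally active vertices when the propagation starts from the seed set $S$. A random RR set is obtained by picking $v\in V$ uniformly at random, running the live-edge process of the model (LT: each vertex $b$ independently picks at most one incoming edge, choosing $(a,b)$ with probability equal to its influence probability $p_{ab}=w_{ab}/W_b$, where $W_b$ is the self-weight of $b$ plus the total weight of its incoming edges; IC: each edge $(a,b)$ is kept independently with its influence probability $w_{ab}\in[0,1]$), and taking the set of all vertices that reach $v$ along live edges. For a collection of RR sets, the degree of $S\subseteq V$ is the number of sets in the collection that contain at least one vertex of $S$. Let $\varepsilon>0$, $0<\delta<1$, and let $k_{\max}\le n/2$ be a natural number. Put $$\Upsilon(\varepsilon,\delta)=\frac{4(e-2)\ln(2/\delta)}{\varepsilon^2},\qquad \Upsilon_1(\varepsilon,\delta)=1+(1+\varepsilon)\,\Upsilon(\varepsilon,\delta),\qquad N=\binom{n}{k_{\max}}.$$ Let $\mathcal R_1$ consist of the first $M_1$ sets of a sequence of independent random RR sets, where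 $M_1$ is a random number such that almost surely the maximum degree $\mathcal D_1^*$ of a vertex in $\mathcal R_1$ equals $\lceil \Upsilon_1(\varepsilon,\tfrac{2\delta}{3n})\rceil$. Let $\mathcal R_2$ consist of the first $$M_2=\left\lceil M_1\,\frac{\ln\frac{3N}{2\delta}}{\ln\frac{2n}{\delta}}\right\rceil$$ sets of a second sequence of independent random RR sets, which is independent of the first sequence together with $M_1$. Let $k\le k_{\max}$, and let $S_k$ be the seed set returned by the greedy algorithm on $\mathcal R_2$: start with the empty set, and $k$ times add a vertex outside the current set for which the degree of the resulting set in $\mathcal R_2$ is largest, ties being broken arbitrarily. Let $S_k^*$ maximize $I(S)$ over all $S\subseteq V$ with $|S|=k$. Then $$\Pr\Big\{I(S_k)\ \ge\ \Big[1-\tfrac1e-\big(2-\tfrac1e\big)\varepsilon\Big]\,I(S_k^*)\Big\}\ \ge\ 1-\delta .$$ -/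

import Mathlib

open MeasureTheory ProbabilityTheory
open scoped NNReal ENNReal

noncomputable section

namespace InfluenceMax

/-! ### Directed social networks and the two propagation models -/

/-- The law of a family of independent finite random choices. -/
def piPMF {ι κ : Type*} [Fintype ι] [Fintype κ] (p : ι → PMF κ) : PMF (ι → κ) := by
  classical
  exact PMF.ofFintype (fun f => ∏ i, p i (f i)) (by
    have h1 : ∀ i, ∑ a, p i a = 1 := fun i => by
      have h := (p i).tsum_coe
      rwa [tsum_fintype] at h
    calc ∑ f : ι → κ, ∏ i, p i (f i)
        = ∏ i, ∑ a, p i a := (Fintype.prod_sum (fun i a => p i a)).symm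
      _ = 1 := by simp [h1])

/-- A network for the Linear Threshold model: directed edges with nonnegative weights, and a
nonnegative self-weight at each vertex. Weights of pairs that are not edges are never used. -/
structure LTNetwork (V : Type*) where
  edges : Set (V × V)
  weight : V → V → ℝ≥0
  selfWeight : V → ℝ≥0

/-- A network for the Independent Cascade model: the weight of an edge is a probability.
Weights of pairs that are not edges are never used. -/
structure ICNetwork (V : Type*) where
  edges : Set (V × V)
  weight : V → V → ℝ≥0
  weight_le_one : ∀ u v, (u, v) ∈ edges → weight u v ≤ 1

/-- The vertices that can reach `v` along live edges. -/
def reverseReachable {V : Type*} [Fintype V] (live : V → V → Prop) (v : V) : Finset V := by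
  classical
  exact Finset.univ.filter fun u => Relation.ReflTransGen live u v

namespace LTNetwork

variable {V : Type*} [Fintype V] (G : LTNetwork V)

open Classical in
/-- The in-neighbours of `v`. -/
def inNbrs (v : V) : Finset V := Finset.univ.filter fun u => (u, v) ∈ G.edges

/-- The total weight `W_v = w_v + ∑ w_{uv}` of `v`. -/
def totalWeight (v : V) : ℝ≥0 := G.selfWeight v + ∑ u ∈ G.inNbrs v, G.weight u v

/-- The influence probability `p_{uv} = w_{uv} / W_v` of an edge. -/
def prob (u v : V) : ℝ≥0 := G.weight u v / G.totalWeight v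

theorem sum_prob_le_one (v : V) : ∑ u ∈ G.inNbrs v, G.prob u v ≤ 1 := by
  unfold prob
  rw [← Finset.sum_div]
  exact div_le_one_of_le₀ (by unfold totalWeight; exact le_add_of_nonneg_left zero_le) zero_le

open Classical in
/-- The set of vertices active in step `i`, for thresholds `thr` and seed set `S`. -/
def active (thr : V → ℝ) (S : Finset V) : ℕ → Finset V
  | 0 => S
  | i + 1 => active thr S i ∪ Finset.univ.filter fun v =>
      thr v ≤ ∑ u ∈ G.inNbrs v ∩ active thr S i, (G.prob u v : ℝ)

open Classical in
/-- The set of vertices that are eventually active. -/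
def finalActive (thr : V → ℝ) (S : Finset V) : Finset V :=
  Finset.univ.filter fun v => ∃ i, v ∈ G.active thr S i

/-- The influence spread of `S`: the expected number of finally active vertices when the
thresholds are independent and uniform on `[0, 1]`. -/
def spread (S : Finset V) : ℝ :=
  ∫ thr : V → ℝ, ((G.finalActive thr S).card : ℝ)
    ∂(Measure.pi fun _ : V => (volume : Measure ℝ).restrict (Set.Icc 0 1))

open Classical in
/-- In the live-edge process `v` picks the incoming edge `(u, v)` with probability `p_{uv}`, and
no incoming edge with the remaining probability. -/
def pick (v : V) : PMF (Option V) :=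
  PMF.ofFintype
    (fun o => ((o.elim (1 - ∑ u ∈ G.inNbrs v, G.prob u v)
      fun u => if u ∈ G.inNbrs v then G.prob u v else 0 : ℝ≥0) : ℝ≥0∞))
    (by
      rw [Fintype.sum_option]
      simp only [Option.elim]
      norm_cast
      rw [Finset.sum_ite_mem, Finset.univ_inter]
      exact tsub_add_cancel_of_le (G.sum_prob_le_one v))

/-- The law of the set of vertices that can reach a uniformly random vertex along live edges. -/
def rrLaw [Nonempty V] : PMF (Finset V) :=
  (PMF.uniformOfFintype V).bind fun v =>
    (piPMF G.pick).map fun L => reverseReachable (fun a b => L b = some a) v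

end LTNetwork

namespace ICNetwork

variable {V : Type*} (G : ICNetwork V)

open Classical in
/-- The probability that `u` succeeds in influencing `v`: the weight of `(u, v)` if it is an edge,
and zero otherwise. -/
def prob (e : V × V) : ℝ≥0 := if e ∈ G.edges then G.weight e.1 e.2 else 0

theorem prob_le_one (e : V × V) : G.prob e ≤ 1 := by
  unfold prob
  split_ifs with h
  · exact G.weight_le_one _ _ h
  · exact zero_le_one

/-- The coin of a pair of vertices: `true` with the influence probability of the pair. -/
def coin (e : V × V) : PMF Bool :=
  PMF.ofFintype (fun b => ((cond b (G.prob e) (1 - G.prob e) : ℝ≥0) : ℝ≥0∞)) (by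
    rw [Fintype.sum_bool]
    simp only [cond_true, cond_false]
    norm_cast
    exact add_tsub_cancel_of_le (G.prob_le_one e))

open Classical in
/-- The set of vertices active in step `i` together with the set of those newly activated in
step `i`. A newly activated `u` makes one attempt on each inactive `v`, which succeeds
if the coin of `(u, v)` shows `true`; since a vertex is newly activated at most once, each coin is
used at most once. -/
def active [Fintype V] (c : V × V → Bool) (S : Finset V) : ℕ → Finset V × Finset V
  | 0 => (S, S)
  | i + 1 =>
      let A := (active c S i).1
      let new := Finset.univ.filter fun v => v ∉ A ∧ ∃ u ∈ (active c S i).2, c (u, v) = true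
      (A ∪ new, new)

open Classical in
/-- The set of vertices that are eventually active. -/
def finalActive [Fintype V] (c : V × V → Bool) (S : Finset V) : Finset V :=
  Finset.univ.filter fun v => ∃ i, v ∈ (active c S i).1

open Classical in
/-- The influence spread of `S`: the expected number of finally active vertices when the coins
are independent. -/
def spread [Fintype V] (S : Finset V) : ℝ :=
  ∑ c : V × V → Bool, (piPMF G.coin c).toReal * ((finalActive c S).card : ℝ)

/-- The law of the set of vertices that can reach a uniformly random vertex along live edges,
where each edge is live independently with its influence probability. -/
def rrLaw [Fintype V] [Nonempty V] : PMF (Finset V) :=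
  (PMF.uniformOfFintype V).bind fun v =>
    (piPMF G.coin).map fun c => reverseReachable (fun a b => c (a, b) = true) v

end ICNetwork

/-- A social network under one of the two propagation models. -/
inductive Network (V : Type*) where
  | lt (G : LTNetwork V)
  | ic (G : ICNetwork V)

namespace Network

variable {V : Type*} [Fintype V]

/-- The influence spread `I(S)`. -/
def spread : Network V → Finset V → ℝ
  | lt G, S => G.spread S
  | ic G, S => G.spread S

/-- The law of a random reverse reachable (RR) set. -/
def rrLaw [Nonempty V] : Network V → PMF (Finset V)
  | lt G => G.rrLaw
  | ic G => G.rrLaw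

end Network

/-! ### Degrees, the greedy algorithm, and the sample sizes -/

section

variable {V : Type*}

open Classical in
/-- The degree of `S` in the collection of the first `M` sets of the sequence `R`: the number of
those sets that contain at least one vertex of `S`. -/
def degree (R : ℕ → Finset V) (M : ℕ) (S : Finset V) : ℕ :=
  ((Finset.range M).filter fun i => (S ∩ R i).Nonempty).card

/-- The largest degree of a vertex in the collection of the first `M` sets of `R`. -/
def maxDegree [Fintype V] (R : ℕ → Finset V) (M : ℕ) : ℕ :=
  Finset.univ.sup fun u : V => degree R M {u}

open Classical in
/-- `GreedyOutput D k S`: the greedy algorithm for the set function `D` can return `S` after `k`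
rounds. In each round a vertex outside the current set that maximizes `D` is added; ties may be
broken in any way. -/
inductive GreedyOutput (D : Finset V → ℕ) : ℕ → Finset V → Prop
  | zero : GreedyOutput D 0 ∅
  | succ (k : ℕ) (S : Finset V) (v : V) : GreedyOutput D k S → v ∉ S →
      (∀ u, u ∉ S → D (insert u S) ≤ D (insert v S)) → GreedyOutput D (k + 1) (insert v S)

/-- `S` is an optimal `k`-seed set for the spread function `I`. -/
def IsOptimalSeedSet (I : Finset V → ℝ) (k : ℕ) (S : Finset V) : Prop :=
  S.card = k ∧ ∀ T : Finset V, T.card = k → I T ≤ I S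

end

/-- `Υ(ε, δ) = 4 (e - 2) ln(2/δ) / ε²`. -/
def Upsilon (ε δ : ℝ) : ℝ := 4 * (Real.exp 1 - 2) * Real.log (2 / δ) / ε ^ 2

/-- `Υ₁(ε, δ) = 1 + (1 + ε) Υ(ε, δ)`. -/
def Upsilon₁ (ε δ : ℝ) : ℝ := 1 + (1 + ε) * Upsilon ε δ

/-- The size of the second collection, `M₁ ln(3N/(2δ)) / ln(2n/δ)` with `N = n.choose kmax`,
rounded up to an integer. -/
def secondSize (n kmax : ℕ) (δ : ℝ) (M₁ : ℕ) : ℕ :=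
  ⌈(M₁ : ℝ) * Real.log (3 * (n.choose kmax : ℝ) / (2 * δ)) / Real.log (2 * n / δ)⌉₊

end InfluenceMax

end

/-!
The proof has three ingredients.

*RR sets estimate the spread* (`Network.spread_eq`): `I(S) = n Pr[S ∩ R ≠ ∅]` for a random RR set
`R`. In the IC model this is a deterministic identity, since the same coins drive the cascade and
the live edges (`ICNetwork.active_fst_eq_cascade`). In the LT model the two processes live on
different spaces, but in both of them a vertex is activated by a set `A` of active vertices with
probability `∑ p_{uv}` over `u ∈ A` (`LTNetwork.volume_thresholdRule_eq`). A trajectory of active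
sets prescribes the behaviour of every vertex separately, and along an increasing chain of sets the
moment at which a vertex is activated has a law that depends only on these marginals. So every
trajectory has the same probability in both processes (`measure_exists_mem_cascade_eq`).

*Greedy is a `1 - 1/e` approximation for coverage* (`GreedyOutput.one_sub_inv_exp_mul_le`).

*Chernoff bounds* (`measureReal_le_degree`, `measureReal_degree_le`) with exponent
`ε² / (4 (e - 2))`, from `exp x - 1 - x ≤ (e - 2) x²`. Let `q` be the probability that an RR set
meets the optimal `k`-set. Every vertex has probability at most `q`, so a union bound over the
vertices shows that, up to an event of probability `δ / 3`, a degree of `Υ₁` is not reached within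
the first `Υ / q` sets, whence `M₁ > Υ / q`. Then `M₂` is so large that one tail event for each
`k`-set has total probability at most `N · 2δ / (3N) = 2δ / 3` (`measure_badSample_le`). This bound
holds for each fixed value of `M₁`, and therefore for the random one, which is independent of the
second sequence (`measure_random_index_le`). Outside these events, for a greedy set `S` that is not
the optimal set `T`, the degrees `D` satisfy
`(1 - 1/e)(1 - ε) q ≤ (1 - 1/e) D(T) / M₂ ≤ D(S) / M₂ ≤ Pr[S ∩ R ≠ ∅] + ε q`,
which is the claim. The Chernoff bounds are needed only for `ε ≤ 1 / 2`, because for larger `ε` the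
guarantee is vacuous.
-/

namespace InfluenceMax

/-! ### The greedy algorithm for coverage -/

section Coverage

variable {V : Type*}

open Classical in
theorem degree_eq_sum (R : ℕ → Finset V) (M : ℕ) (S : Finset V) :
    (degree R M S : ℝ) = ∑ i ∈ Finset.range M, if (S ∩ R i).Nonempty then (1 : ℝ) else 0 := by
  simp [degree, Finset.sum_boole]

theorem degree_mono_left (R : ℕ → Finset V) (S : Finset V) : Monotone fun M => degree R M S := by
  intro M N h
  exact Finset.card_le_card (Finset.filter_subset_filter _ (Finset.range_subset_range.2 h))

theorem degree_mono_right (R : ℕ → Finset V) (M : ℕ) : Monotone (degree R M) := by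
  classical
  intro S T h
  unfold degree
  refine Finset.card_le_card fun i hi => ?_
  rw [Finset.mem_filter] at hi ⊢
  exact ⟨hi.1, hi.2.mono (Finset.inter_subset_inter_right h)⟩

open Classical in
/-- Submodularity of coverage: what `T` covers beyond `S` is at most the sum of what its single
elements cover beyond `S`. -/
theorem degree_le_add_sum (R : ℕ → Finset V) (M : ℕ) (S T : Finset V) :
    (degree R M T : ℝ) ≤
      degree R M S + ∑ u ∈ T \ S, ((degree R M (insert u S) : ℝ) - degree R M S) := by
  simp only [degree_eq_sum, ← Finset.sum_sub_distrib]
  rw [Finset.sum_comm, ← Finset.sum_add_distrib]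
  refine Finset.sum_le_sum fun i _ => ?_
  by_cases hS : (S ∩ R i).Nonempty
  · have h (u : V) : (insert u S ∩ R i).Nonempty :=
      hS.mono (Finset.inter_subset_inter_right (Finset.subset_insert u S))
    simp only [h, hS, if_true, sub_self, Finset.sum_const_zero, add_zero]
    split_ifs <;> norm_num
  · simp only [hS, if_false, sub_zero, zero_add]
    have hnn : ∀ u ∈ T \ S, (0 : ℝ) ≤ if (insert u S ∩ R i).Nonempty then (1 : ℝ) else 0 :=
      fun u _ => by split_ifs <;> norm_num
    split_ifs with hT
    · obtain ⟨u, hu⟩ := hT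
      rw [Finset.mem_inter] at hu
      have huS : u ∉ S := fun h => hS ⟨u, Finset.mem_inter.2 ⟨h, hu.2⟩⟩
      refine le_trans ?_ (Finset.single_le_sum hnn (Finset.mem_sdiff.2 ⟨hu.1, huS⟩))
      rw [if_pos ⟨u, Finset.mem_inter.2 ⟨Finset.mem_insert_self u S, hu.2⟩⟩]
    · exact Finset.sum_nonneg hnn

theorem GreedyOutput.card_eq {D : Finset V → ℕ} {k : ℕ} {S : Finset V} (h : GreedyOutput D k S) :
    S.card = k := by
  classical
  induction h with
  | zero => simp
  | succ k S v _ hv _ ih => rw [← ih]; convert Finset.card_insert_of_notMem hv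

/-- Each greedy round closes at least a `1 / k` fraction of the gap to any `k`-set. -/
theorem GreedyOutput.gap_le {R : ℕ → Finset V} {M j : ℕ} {S : Finset V}
    (h : GreedyOutput (degree R M) j S) {k : ℕ} (hk : 0 < k) {T : Finset V} (hT : T.card = k) :
    (degree R M T : ℝ) - degree R M S ≤ (1 - 1 / (k : ℝ)) ^ j * degree R M T := by
  classical
  have hk' : (0 : ℝ) < k := Nat.cast_pos.2 hk
  have hk1 : (1 : ℝ) ≤ k := Nat.one_le_cast.2 hk
  have hfac : 0 ≤ 1 - 1 / (k : ℝ) := by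
    rw [sub_nonneg, div_le_one hk']; exact hk1
  induction h with
  | zero => simp
  | succ j S v _ hv hmax ih =>
    set d : ℝ := (degree R M (insert v S) : ℝ) - degree R M S with hd
    have hd0 : 0 ≤ d :=
      sub_nonneg.2 (Nat.cast_le.2 (degree_mono_right R M (Finset.subset_insert v S)))
    have hsum : ∑ u ∈ T \ S, ((degree R M (insert u S) : ℝ) - degree R M S) ≤ k * d := by
      calc ∑ u ∈ T \ S, ((degree R M (insert u S) : ℝ) - degree R M S)
          ≤ ∑ _u ∈ T \ S, d := Finset.sum_le_sum fun u hu =>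
            sub_le_sub_right (Nat.cast_le.2 (hmax u (Finset.mem_sdiff.1 hu).2)) _
        _ = ((T \ S).card : ℝ) * d := by rw [Finset.sum_const, nsmul_eq_mul]
        _ ≤ k * d := by
            refine mul_le_mul_of_nonneg_right (Nat.cast_le.2 ?_) hd0
            exact hT ▸ Finset.card_le_card Finset.sdiff_subset
    have hsub := degree_le_add_sum R M S T
    have hgap : ((degree R M T : ℝ) - degree R M S) / k ≤ d := by
      rw [div_le_iff₀ hk']
      convert (sub_le_iff_le_add'.2 (hsub.trans (add_le_add_right hsum _))) using 1
      ring
    calc (degree R M T : ℝ) - degree R M (insert v S)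
        = ((degree R M T : ℝ) - degree R M S) - d := by rw [hd]; ring
      _ ≤ ((degree R M T : ℝ) - degree R M S) - ((degree R M T : ℝ) - degree R M S) / k := by
          linarith
      _ = (1 - 1 / (k : ℝ)) * ((degree R M T : ℝ) - degree R M S) := by ring
      _ ≤ (1 - 1 / (k : ℝ)) * ((1 - 1 / (k : ℝ)) ^ j * degree R M T) :=
          mul_le_mul_of_nonneg_left ih hfac
      _ = (1 - 1 / (k : ℝ)) ^ (j + 1) * degree R M T := by ring

/-- The approximation guarantee of the greedy algorithm for maximum coverage. -/
theorem GreedyOutput.one_sub_inv_exp_mul_le {R : ℕ → Finset V} {M k : ℕ} {S : Finset V}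
    (h : GreedyOutput (degree R M) k S) (hk : 0 < k) {T : Finset V} (hT : T.card = k) :
    (1 - 1 / Real.exp 1) * (degree R M T : ℝ) ≤ degree R M S := by
  have hgap := h.gap_le hk hT
  have hk1 : (1 : ℝ) ≤ k := Nat.one_le_cast.2 hk
  have hpow : (1 - 1 / (k : ℝ)) ^ k ≤ 1 / Real.exp 1 := by
    rw [one_div (Real.exp 1), ← Real.exp_neg]
    exact Real.one_sub_div_pow_le_exp_neg hk1
  have := hgap.trans (mul_le_mul_of_nonneg_right hpow (Nat.cast_nonneg _))
  linarith

theorem choose_le_choose_of_le_half {n a b : ℕ} (hab : a ≤ b) (hb : 2 * b ≤ n) :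
    n.choose a ≤ n.choose b := by
  induction b, hab using Nat.le_induction with
  | base => exact le_rfl
  | succ b _ ih => exact (ih (by lia)).trans (Nat.choose_le_succ_of_lt_half_left (by lia))

end Coverage

/-! ### Chernoff bounds for degrees -/

/-- The estimate of the Chernoff exponent. The optimal parameters `x = ± ε / (2 (e - 2))` lie in
its range for `ε ≤ 1 / 2`. -/
theorem exp_sub_one_sub_le {x : ℝ} (hx : |x| ≤ 1 / 2) :
    Real.exp x - 1 - x ≤ (Real.exp 1 - 2) * x ^ 2 := by
  have h := Real.exp_bound (x := x) (by linarith) (n := 3) (by norm_num)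
  simp only [Finset.sum_range_succ, Finset.sum_range_zero, Nat.factorial] at h
  have h2 := (abs_le.1 h).2
  have h3 : |x| ^ 3 ≤ 1 / 2 * x ^ 2 := by
    rw [← sq_abs x, pow_succ, mul_comm]
    exact mul_le_mul_of_nonneg_right hx (sq_nonneg _)
  have he := Real.exp_one_gt_d9
  norm_num at h2
  nlinarith [sq_nonneg x]

section Concentration

variable {V : Type*}

open Classical in
/-- The probability that a random set with law `ν` meets `S`. -/
noncomputable def hitProb (ν : Measure (Finset V)) (S : Finset V) : ℝ :=
  ν.real {R | (S ∩ R).Nonempty}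

theorem hitProb_nonneg (ν : Measure (Finset V)) (S : Finset V) : 0 ≤ hitProb ν S :=
  measureReal_nonneg

theorem hitProb_mono (ν : Measure (Finset V)) [IsFiniteMeasure ν] {S T : Finset V} (h : S ⊆ T) :
    hitProb ν S ≤ hitProb ν T := by
  classical
  unfold hitProb
  refine measureReal_mono fun R hR => ?_
  exact Finset.Nonempty.mono (Finset.inter_subset_inter_right h) hR

open Classical in
/-- The indicator of the event that a set meets `S`, as a function of the set. -/
noncomputable def hit (S R : Finset V) : ℝ := if (S ∩ R).Nonempty then 1 else 0

theorem degree_eq_sum_hit {Ω : Type*} (R : ℕ → Ω → Finset V) (M : ℕ) (S : Finset V) (ω : Ω) :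
    (degree (fun i => R i ω) M S : ℝ) =
      (∑ i ∈ Finset.range M, fun ω => hit S (R i ω)) ω := by
  rw [degree_eq_sum, Finset.sum_apply]
  rfl

variable [Fintype V] {Ω : Type*} [MeasurableSpace Ω] {P : Measure Ω}

theorem mgf_hit [IsProbabilityMeasure P] {ν : Measure (Finset V)} {R : Ω → Finset V}
    (hR : Measurable R) (hlaw : P.map R = ν) (S : Finset V) (t : ℝ) :
    mgf (fun ω => hit S (R ω)) P t = 1 + hitProb ν S * (Real.exp t - 1) := by
  classical
  have hmeas : MeasurableSet {ω | (S ∩ R ω).Nonempty} :=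
    hR (MeasurableSet.of_discrete (s := {A : Finset V | (S ∩ A).Nonempty}))
  have hfun : (fun ω => Real.exp (t * hit S (R ω))) = fun ω =>
      1 + {ω | (S ∩ R ω).Nonempty}.indicator (fun _ => Real.exp t - 1) ω := by
    funext ω
    by_cases h : (S ∩ R ω).Nonempty
    · rw [Set.indicator_of_mem (show ω ∈ {ω | (S ∩ R ω).Nonempty} from h), hit,
        if_pos (by convert h)]
      simp
    · rw [Set.indicator_of_notMem (show ω ∉ {ω | (S ∩ R ω).Nonempty} from h), hit,
        if_neg (by convert h)]
      simp
  rw [mgf, hfun, integral_add (integrable_const _) ((integrable_const _).indicator hmeas),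
    integral_indicator_const _ hmeas, integral_const, hitProb, ← hlaw,
    map_measureReal_apply hR MeasurableSet.of_discrete]
  simp only [probReal_univ, smul_eq_mul, mul_one]
  congr 3

variable [IsProbabilityMeasure P] {ν : Measure (Finset V)} {R : ℕ → Ω → Finset V}

theorem measurable_degree (hR : ∀ i, Measurable (R i)) (M : ℕ) (S : Finset V) :
    Measurable fun ω => (degree (fun i => R i ω) M S : ℝ) := by
  simp only [degree_eq_sum_hit, Finset.sum_apply]
  exact Finset.measurable_sum _ fun i _ => (Measurable.of_discrete (f := hit S)).comp (hR i)

theorem mgf_degree_le (hR : ∀ i, Measurable (R i)) (hlaw : ∀ i, P.map (R i) = ν)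
    (hind : iIndepFun R P) (M : ℕ) (S : Finset V) (t : ℝ) :
    mgf (fun ω => (degree (fun i => R i ω) M S : ℝ)) P t ≤
      Real.exp (M * (hitProb ν S * (Real.exp t - 1))) := by
  simp only [degree_eq_sum_hit]
  have hind' : iIndepFun (fun i ω => hit S (R i ω)) P :=
    hind.comp (fun _ => hit S) fun _ => Measurable.of_discrete
  rw [hind'.mgf_sum fun i => (Measurable.of_discrete (f := hit S)).comp (hR i)]
  simp only [mgf_hit (hR _) (hlaw _), Finset.prod_const, Finset.card_range]
  rw [Real.exp_nat_mul]
  refine pow_le_pow_left₀ ?_ ?_ M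
  · rw [← mgf_hit (hR 0) (hlaw 0)]; exact mgf_nonneg
  · rw [add_comm]; exact Real.add_one_le_exp _

theorem integrable_exp_degree (hR : ∀ i, Measurable (R i)) (M : ℕ) (S : Finset V) (t : ℝ) :
    Integrable (fun ω => Real.exp (t * (degree (fun i => R i ω) M S : ℝ))) P := by
  refine Integrable.of_bound
    ((measurable_degree hR M S).const_mul t).exp.aestronglyMeasurable (Real.exp (|t| * M))
    (.of_forall fun ω => ?_)
  rw [Real.norm_eq_abs, Real.abs_exp, Real.exp_le_exp]
  have hdeg : (degree (fun i => R i ω) M S : ℝ) ≤ M := by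
    refine Nat.cast_le.2 ?_
    unfold degree
    exact (Finset.card_filter_le _ _).trans (Finset.card_range M).le
  exact mul_le_mul (le_abs_self t) hdeg (Nat.cast_nonneg _) (abs_nonneg t)

/-- Upper tail of the degree. The deviation is measured relative to an upper bound `A` of the mean
and not relative to the mean, so that one value of `A` serves sets of different probabilities. -/
theorem measureReal_le_degree (hR : ∀ i, Measurable (R i)) (hlaw : ∀ i, P.map (R i) = ν)
    (hind : iIndepFun R P) (M : ℕ) (S : Finset V) {A ε a : ℝ} (hε : 0 ≤ ε) (hε' : ε ≤ 1 / 2)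
    (hA : M * hitProb ν S ≤ A) (ha : M * hitProb ν S + ε * A ≤ a) :
    P.real {ω | a ≤ degree (fun i => R i ω) M S} ≤
      Real.exp (-(A * ε ^ 2 / (4 * (Real.exp 1 - 2)))) := by
  have he := Real.exp_one_gt_d9
  have hc : 0 < Real.exp 1 - 2 := by linarith
  set t := ε / (2 * (Real.exp 1 - 2)) with ht
  have ht0 : 0 ≤ t := by positivity
  have ht1 : t ≤ 1 / 2 := by rw [ht, div_le_iff₀ (by positivity)]; linarith
  have hq := exp_sub_one_sub_le (x := t) (by rwa [abs_of_nonneg ht0])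
  have hq0 : 0 ≤ Real.exp t - 1 - t := by linarith [Real.add_one_le_exp t]
  have hA0 : 0 ≤ A := le_trans (mul_nonneg (Nat.cast_nonneg _) (hitProb_nonneg ν S)) hA
  refine (measure_ge_le_exp_mul_mgf a ht0 (integrable_exp_degree hR M S t)).trans ?_
  refine (mul_le_mul_of_nonneg_left (mgf_degree_le hR hlaw hind M S t) (Real.exp_nonneg _)).trans ?_
  rw [← Real.exp_add, Real.exp_le_exp]
  calc -t * a + M * (hitProb ν S * (Real.exp t - 1))
      ≤ -t * (M * hitProb ν S + ε * A) + M * (hitProb ν S * (Real.exp t - 1)) := by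
        nlinarith [mul_le_mul_of_nonneg_left ha ht0]
    _ = M * hitProb ν S * (Real.exp t - 1 - t) - t * ε * A := by ring
    _ ≤ A * ((Real.exp 1 - 2) * t ^ 2) - t * ε * A :=
        sub_le_sub_right (mul_le_mul hA hq hq0 hA0) _
    _ = -(A * ε ^ 2 / (4 * (Real.exp 1 - 2))) := by rw [ht]; field_simp; ring

/-- Lower tail of the degree. -/
theorem measureReal_degree_le (hR : ∀ i, Measurable (R i)) (hlaw : ∀ i, P.map (R i) = ν)
    (hind : iIndepFun R P) (M : ℕ) (S : Finset V) {ε : ℝ} (hε : 0 ≤ ε) (hε' : ε ≤ 1 / 2) :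
    P.real {ω | (degree (fun i => R i ω) M S : ℝ) ≤ (1 - ε) * (M * hitProb ν S)} ≤
      Real.exp (-(M * hitProb ν S * ε ^ 2 / (4 * (Real.exp 1 - 2)))) := by
  have he := Real.exp_one_gt_d9
  have hc : 0 < Real.exp 1 - 2 := by linarith
  set t := -(ε / (2 * (Real.exp 1 - 2))) with ht
  have ht0 : t ≤ 0 := by rw [ht, neg_nonpos]; positivity
  have ht1 : -t ≤ 1 / 2 := by rw [ht, neg_neg, div_le_iff₀ (by positivity)]; linarith
  have hq := exp_sub_one_sub_le (x := t) (by rwa [abs_of_nonpos ht0])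
  have hA0 : 0 ≤ M * hitProb ν S := mul_nonneg (Nat.cast_nonneg _) (hitProb_nonneg ν S)
  refine (measure_le_le_exp_mul_mgf _ ht0 (integrable_exp_degree hR M S t)).trans ?_
  refine (mul_le_mul_of_nonneg_left (mgf_degree_le hR hlaw hind M S t) (Real.exp_nonneg _)).trans ?_
  rw [← Real.exp_add, Real.exp_le_exp]
  calc -t * ((1 - ε) * (M * hitProb ν S)) + M * (hitProb ν S * (Real.exp t - 1))
      = M * hitProb ν S * (Real.exp t - 1 - t) + t * ε * (M * hitProb ν S) := by ring
    _ ≤ M * hitProb ν S * ((Real.exp 1 - 2) * t ^ 2) + t * ε * (M * hitProb ν S) :=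
        add_le_add_left (mul_le_mul_of_nonneg_left hq hA0) _
    _ = -(M * hitProb ν S * ε ^ 2 / (4 * (Real.exp 1 - 2))) := by rw [ht]; field_simp; ring

end Concentration

/-! ### Activation processes -/

section Activation

variable {V : Type*} [Fintype V]

open Classical in
/-- The set of vertices active in step `i`, starting from `S`, when an inactive vertex `v` becomes
active as soon as the active set `A` satisfies `f v A`. -/
noncomputable def cascade (f : V → Finset V → Prop) (S : Finset V) : ℕ → Finset V
  | 0 => S
  | i + 1 => cascade f S i ∪ Finset.univ.filter fun v => f v (cascade f S i)

theorem mem_cascade_succ (f : V → Finset V → Prop) (S : Finset V) (i : ℕ) (v : V) :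
    v ∈ cascade f S (i + 1) ↔ v ∈ cascade f S i ∨ f v (cascade f S i) := by
  simp [cascade]

theorem cascade_mono (f : V → Finset V → Prop) (S : Finset V) : Monotone (cascade f S) :=
  monotone_nat_of_le_succ fun i v hv => (mem_cascade_succ f S i v).2 (Or.inl hv)

/-- For the rule "some active `u` has a live edge to `v`", the eventually active vertices are
those reachable from the seed set along live edges. -/
theorem exists_mem_cascade_iff_reachable (live : V → V → Prop) (S : Finset V) (v : V) :
    (∃ i, v ∈ cascade (fun b A => ∃ a ∈ A, live a b) S i) ↔
      ∃ u ∈ S, Relation.ReflTransGen live u v := by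
  constructor
  · rintro ⟨i, hi⟩
    induction i generalizing v with
    | zero => exact ⟨v, hi, .refl⟩
    | succ i ih =>
      rcases (mem_cascade_succ _ S i v).1 hi with h | ⟨a, ha, hav⟩
      · exact ih v h
      · obtain ⟨u, hu, hua⟩ := ih a ha
        exact ⟨u, hu, hua.tail hav⟩
  · rintro ⟨u, hu, huv⟩
    induction huv with
    | refl => exact ⟨0, hu⟩
    | tail _ hbc ih =>
      obtain ⟨i, hi⟩ := ih
      exact ⟨i + 1, (mem_cascade_succ _ S i _).2 (Or.inr ⟨_, hi, hbc⟩)⟩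

end Activation

/-! ### Activation processes with equal marginals -/

section Comparison

section Chain

variable {Z α : Type*} {k : Z → α → Prop} {b : ℕ → α} {c : ℕ → Prop}

theorem setOf_forall_lt_succ_not [Preorder α] (hk : ∀ z, Monotone (k z)) (hb : Monotone b) (t : ℕ) :
    {z | ∀ i < t + 1, ¬ k z (b i)} = {z | k z (b t)}ᶜ := by
  ext z
  exact ⟨fun hz => hz t (Nat.lt_succ_self t), fun hz i hi hki =>
    hz (hk z (hb (Nat.lt_succ_iff.1 hi)) hki)⟩

/-- As long as `c t` fails, the prescription says that the predicate has not become true. -/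
theorem setOf_chain_eq_setOf_not (hc : Monotone c) {t : ℕ} (ht : ¬ c t) :
    {z | ∀ i < t, (c (i + 1) ↔ c i ∨ k z (b i))} = {z | ∀ i < t, ¬ k z (b i)} := by
  ext z
  refine forall₂_congr fun i hi => ?_
  have h1 : ¬ c (i + 1) := fun h => ht (hc (Nat.succ_le_of_lt hi) h)
  have h2 : ¬ c i := fun h => ht (hc hi.le h)
  simp [h1, h2]

theorem setOf_chain_succ_of_true {t : ℕ} (ht : c t) (ht' : c (t + 1)) :
    {z | ∀ i < t + 1, (c (i + 1) ↔ c i ∨ k z (b i))} =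
      {z | ∀ i < t, (c (i + 1) ↔ c i ∨ k z (b i))} := by
  ext z
  simp only [Set.mem_ofPred_eq, Nat.forall_lt_succ_right]
  simp [ht, ht']

theorem setOf_chain_succ_of_first (hc : Monotone c) {t : ℕ} (ht : ¬ c t) (ht' : c (t + 1)) :
    {z | ∀ i < t + 1, (c (i + 1) ↔ c i ∨ k z (b i))} =
      {z | ∀ i < t, ¬ k z (b i)} \ {z | ∀ i < t + 1, ¬ k z (b i)} := by
  rw [← setOf_chain_eq_setOf_not hc ht]
  ext z
  have hz : z ∈ {z | ∀ i < t, (c (i + 1) ↔ c i ∨ k z (b i))} ↔ ∀ i < t, ¬ k z (b i) := by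
    rw [setOf_chain_eq_setOf_not hc ht]; rfl
  simp only [Set.mem_ofPred_eq, Set.mem_sdiff, Nat.forall_lt_succ_right] at hz ⊢
  rw [hz]
  simp only [ht, ht', false_or, true_iff]
  tauto

theorem setOf_forall_lt_succ_not_subset (t : ℕ) :
    {z | ∀ i < t + 1, ¬ k z (b i)} ⊆ {z | ∀ i < t, ¬ k z (b i)} :=
  fun _ hz i hi => hz i (hi.trans (Nat.lt_succ_self t))

end Chain

variable {X Y : Type*}

/-- Along a chain `b`, a random monotone predicate becomes true at a prescribed time with a
probability that depends only on the probabilities of its single values. The sequence `c` of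
propositions prescribes the time: `c i` says that the predicate has become true before `i`. -/
theorem measure_chain_eq [MeasurableSpace X] [MeasurableSpace Y] {α : Type*} [Preorder α]
    {μ : Measure X} {ν : Measure Y}
    [IsProbabilityMeasure μ] [IsProbabilityMeasure ν] {f : X → α → Prop} {g : Y → α → Prop}
    (hf : ∀ x, Monotone (f x)) (hg : ∀ y, Monotone (g y))
    (hfm : ∀ a, MeasurableSet {x | f x a}) (hgm : ∀ a, MeasurableSet {y | g y a})
    (h : ∀ a, μ {x | f x a} = ν {y | g y a}) {b : ℕ → α} (hb : Monotone b)
    {c : ℕ → Prop} (hc : Monotone c) (t : ℕ) :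
    μ {x | ∀ i < t, (c (i + 1) ↔ c i ∨ f x (b i))} =
      ν {y | ∀ i < t, (c (i + 1) ↔ c i ∨ g y (b i))} := by
  have none_eq : ∀ t, μ {x | ∀ i < t, ¬ f x (b i)} = ν {y | ∀ i < t, ¬ g y (b i)} := by
    rintro (_ | t)
    · simp
    · rw [setOf_forall_lt_succ_not hf hb, setOf_forall_lt_succ_not hg hb,
        prob_compl_eq_one_sub (hfm _), prob_compl_eq_one_sub (hgm _), h]
  induction t with
  | zero => simp
  | succ t ih =>
    by_cases ht : c t
    · have ht' : c (t + 1) := hc (Nat.le_succ t) ht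
      rw [setOf_chain_succ_of_true ht ht', setOf_chain_succ_of_true ht ht', ih]
    · by_cases ht' : c (t + 1)
      · have meas_f : MeasurableSet {x | ∀ i < t + 1, ¬ f x (b i)} := by
          rw [setOf_forall_lt_succ_not hf hb]; exact (hfm _).compl
        have meas_g : MeasurableSet {y | ∀ i < t + 1, ¬ g y (b i)} := by
          rw [setOf_forall_lt_succ_not hg hb]; exact (hgm _).compl
        rw [setOf_chain_succ_of_first hc ht ht', setOf_chain_succ_of_first hc ht ht',
          measure_sdiff (setOf_forall_lt_succ_not_subset t) meas_f.nullMeasurableSet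
            (measure_ne_top _ _),
          measure_sdiff (setOf_forall_lt_succ_not_subset t) meas_g.nullMeasurableSet
            (measure_ne_top _ _), none_eq, none_eq]
      · rw [setOf_chain_eq_setOf_not hc ht', setOf_chain_eq_setOf_not hc ht', none_eq]

variable {V : Type*} [Fintype V]

/-- The active sets up to step `t`. -/
noncomputable def trajectory (f : V → X → Finset V → Prop) (S : Finset V) (t : ℕ) (x : V → X) :
    Fin (t + 1) → Finset V :=
  fun i => cascade (fun v => f v (x v)) S i

/-- A trajectory prescribes the behaviour of every vertex separately. A finite sequence of sets is
prolonged by its last member to a sequence on `ℕ`. -/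
theorem trajectory_preimage_singleton (f : V → X → Finset V → Prop) (S : Finset V) (t : ℕ)
    (b : Fin (t + 1) → Finset V) {c : ℕ → Finset V}
    (hc : c = fun i => b ⟨min i t, Nat.lt_succ_iff.2 (min_le_right i t)⟩) (h0 : c 0 = S) :
    trajectory f S t ⁻¹' {b} =
      Set.univ.pi fun v => {x | ∀ i < t, (v ∈ c (i + 1) ↔ v ∈ c i ∨ f v x (c i))} := by
  have hcb : ∀ i : Fin (t + 1), c i = b i := fun i => by
    rw [hc]
    exact congrArg b (Fin.ext (min_eq_left (Nat.lt_succ_iff.1 i.2)))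
  ext x
  simp only [Set.mem_preimage, Set.mem_singleton_iff, Set.mem_univ_pi, Set.mem_ofPred_eq]
  constructor
  · intro h v i hi
    have key : ∀ j ≤ t, cascade (fun v => f v (x v)) S j = c j := fun j hj => by
      have := congrFun h ⟨j, Nat.lt_succ_iff.2 hj⟩
      rw [← hcb] at this
      exact this
    rw [← key _ hi, ← key _ hi.le, mem_cascade_succ]
  · intro h
    have key : ∀ j ≤ t, cascade (fun v => f v (x v)) S j = c j := by
      intro j
      induction j with
      | zero => intro _; exact h0.symm
      | succ j ih =>
        intro hj
        ext v
        rw [mem_cascade_succ, ih (Nat.le_of_succ_le hj), h v j hj]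
    funext i
    rw [← hcb]
    exact key i (Nat.lt_succ_iff.1 i.2)

theorem trajectory_preimage_singleton_eq_empty (f : V → X → Finset V → Prop) (S : Finset V) (t : ℕ)
    (b : Fin (t + 1) → Finset V) {c : ℕ → Finset V}
    (hc : c = fun i => b ⟨min i t, Nat.lt_succ_iff.2 (min_le_right i t)⟩)
    (h : ¬ (c 0 = S ∧ Monotone c)) : trajectory f S t ⁻¹' {b} = ∅ := by
  rw [Set.eq_empty_iff_forall_notMem]
  rintro x rfl
  refine h ⟨?_, ?_⟩
  · rw [hc]
    simp [trajectory, cascade]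
  · rw [hc]
    exact fun i j hij => cascade_mono _ S (min_le_min_right t hij)

theorem setOf_mem_cascade (f : V → X → Finset V → Prop) (S : Finset V) (t : ℕ) (v : V) :
    {x : V → X | v ∈ cascade (fun v => f v (x v)) S t} =
      trajectory f S t ⁻¹' {b | v ∈ b (Fin.last t)} := by
  ext x
  rfl

variable [MeasurableSpace X] [MeasurableSpace Y]

theorem measurable_trajectory {f : V → X → Finset V → Prop}
    (hfm : ∀ v A, MeasurableSet {x | f v x A}) (S : Finset V) (t : ℕ) :
    Measurable (trajectory f S t) := by
  refine measurable_to_countable' fun b => ?_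
  by_cases h : b ⟨min 0 t, Nat.lt_succ_iff.2 (min_le_right 0 t)⟩ = S
  · rw [trajectory_preimage_singleton f S t b rfl h]
    refine MeasurableSet.univ_pi fun v => ?_
    simp only [Set.ofPred_forall]
    refine MeasurableSet.iInter fun i => MeasurableSet.iInter fun _ => ?_
    exact MeasurableSet.iff (.const _) ((MeasurableSet.const _).union (hfm v _))
  · rw [trajectory_preimage_singleton_eq_empty f S t b rfl fun hc => h hc.1]
    exact .empty

theorem measurableSet_mem_cascade {f : V → X → Finset V → Prop}
    (hfm : ∀ v A, MeasurableSet {x | f v x A}) (S : Finset V) (t : ℕ) (v : V) :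
    MeasurableSet {x : V → X | v ∈ cascade (fun v => f v (x v)) S t} := by
  rw [setOf_mem_cascade]
  exact measurable_trajectory hfm S t .of_discrete

/-- The probability that a vertex is eventually active depends only on the marginal activation
probabilities of the vertices: both processes give the same probability to every trajectory. -/
theorem measure_exists_mem_cascade_eq {μ : V → Measure X} {ν : V → Measure Y}
    [∀ v, IsProbabilityMeasure (μ v)] [∀ v, IsProbabilityMeasure (ν v)]
    {f : V → X → Finset V → Prop} {g : V → Y → Finset V → Prop}
    (hf : ∀ v x, Monotone (f v x)) (hg : ∀ v y, Monotone (g v y))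
    (hfm : ∀ v A, MeasurableSet {x | f v x A}) (hgm : ∀ v A, MeasurableSet {y | g v y A})
    (h : ∀ v A, μ v {x | f v x A} = ν v {y | g v y A}) (S : Finset V) (v : V) :
    Measure.pi μ {x | ∃ i, v ∈ cascade (fun v => f v (x v)) S i} =
      Measure.pi ν {y | ∃ i, v ∈ cascade (fun v => g v (y v)) S i} := by
  have traj (t : ℕ) : (Measure.pi μ).map (trajectory f S t) =
      (Measure.pi ν).map (trajectory g S t) := by
    refine Measure.ext_of_singleton fun b => ?_
    rw [Measure.map_apply (measurable_trajectory hfm S t) (measurableSet_singleton b),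
      Measure.map_apply (measurable_trajectory hgm S t) (measurableSet_singleton b)]
    set c : ℕ → Finset V := fun i => b ⟨min i t, Nat.lt_succ_iff.2 (min_le_right i t)⟩ with hc
    by_cases hgood : c 0 = S ∧ Monotone c
    · rw [trajectory_preimage_singleton f S t b hc hgood.1,
        trajectory_preimage_singleton g S t b hc hgood.1, Measure.pi_pi, Measure.pi_pi]
      exact Finset.prod_congr rfl fun v _ => measure_chain_eq (hf v) (hg v) (hfm v) (hgm v) (h v)
        hgood.2 (c := fun i => v ∈ c i) (fun _ _ hij hv => hgood.2 hij hv) t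
    · rw [trajectory_preimage_singleton_eq_empty f S t b hc hgood,
        trajectory_preimage_singleton_eq_empty g S t b hc hgood, measure_empty, measure_empty]
  have step (t : ℕ) : Measure.pi μ {x | v ∈ cascade (fun v => f v (x v)) S t} =
      Measure.pi ν {y | v ∈ cascade (fun v => g v (y v)) S t} := by
    rw [setOf_mem_cascade f, setOf_mem_cascade g,
      ← Measure.map_apply (measurable_trajectory hfm S t) .of_discrete,
      ← Measure.map_apply (measurable_trajectory hgm S t) .of_discrete, traj]
  simp only [Set.ofPred_exists]
  rw [Monotone.measure_iUnion, Monotone.measure_iUnion]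
  · exact iSup_congr step
  · exact fun i j hij y hy => cascade_mono _ S hij hy
  · exact fun i j hij x hx => cascade_mono _ S hij hx

end Comparison

/-! ### Spread as a hitting probability -/

section LiveEdge

theorem piPMF_toMeasure {ι κ : Type*} [Fintype ι] [Fintype κ] [MeasurableSpace κ]
    [MeasurableSingletonClass κ] (p : ι → PMF κ) :
    (piPMF p).toMeasure = Measure.pi fun i => (p i).toMeasure := by
  refine Measure.ext_of_singleton fun f => ?_
  rw [PMF.toMeasure_apply_singleton _ _ (measurableSet_singleton f), Measure.pi_singleton]
  simp only [PMF.toMeasure_apply_singleton _ _ (measurableSet_singleton _)]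
  rfl

variable {V : Type*} [Fintype V]

theorem mem_reverseReachable {live : V → V → Prop} {u v : V} :
    u ∈ reverseReachable live v ↔ Relation.ReflTransGen live u v := by
  simp [reverseReachable]

open Classical in
theorem inter_reverseReachable_nonempty_iff {live : V → V → Prop} {S : Finset V} {v : V} :
    (S ∩ reverseReachable live v).Nonempty ↔ ∃ u ∈ S, Relation.ReflTransGen live u v := by
  simp only [Finset.Nonempty, Finset.mem_inter, mem_reverseReachable]

/-- For a uniformly random root and an independent random live-edge graph, the probability that
the RR set meets `S`, times the number of vertices, is the expected number of vertices that `S`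
reaches. -/
theorem card_mul_hitProb_rr [Nonempty V] {C : Type*} [MeasurableSpace C]
    [DiscreteMeasurableSpace C] (p : PMF C) (live : C → V → V → Prop) (S : Finset V) :
    Fintype.card V * hitProb ((PMF.uniformOfFintype V).bind fun v =>
        p.map fun c => reverseReachable (live c) v).toMeasure S =
      ∑ v, p.toMeasure.real {c | ∃ u ∈ S, Relation.ReflTransGen (live c) u v} := by
  classical
  have hcard : (Fintype.card V : ℝ) ≠ 0 := Nat.cast_ne_zero.2 Fintype.card_ne_zero
  have hmap (v : V) : (p.map fun c => reverseReachable (live c) v).toMeasure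
      {R | (S ∩ R).Nonempty} = p.toMeasure {c | ∃ u ∈ S, Relation.ReflTransGen (live c) u v} := by
    rw [PMF.toMeasure_map_apply _ _ _ .of_discrete .of_discrete]
    congr 1
    ext c
    exact inter_reverseReachable_nonempty_iff
  have hS : hitProb ((PMF.uniformOfFintype V).bind fun v =>
      p.map fun c => reverseReachable (live c) v).toMeasure S =
        ∑ v, (Fintype.card V : ℝ)⁻¹ *
          p.toMeasure.real {c | ∃ u ∈ S, Relation.ReflTransGen (live c) u v} := by
    have := PMF.toMeasure_bind_apply (PMF.uniformOfFintype V)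
      (fun v => p.map fun c => reverseReachable (live c) v) {R | (S ∩ R).Nonempty} .of_discrete
    simp only [hmap, PMF.uniformOfFintype_apply, tsum_fintype] at this
    rw [hitProb, Measure.real]
    convert congrArg ENNReal.toReal this using 1
    rw [ENNReal.toReal_sum fun v _ => ENNReal.mul_ne_top (by simp) (measure_ne_top _ _)]
    simp [ENNReal.toReal_mul, Measure.real]
  rw [hS, Finset.mul_sum]
  exact Finset.sum_congr rfl fun v _ => mul_inv_cancel_left₀ hcard _

end LiveEdge

namespace LTNetwork

variable {V : Type*}

/-- The activation rule of the live-edge process: the picked in-neighbour is active. -/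
def pickRule (_v : V) (o : Option V) (A : Finset V) : Prop := ∃ u ∈ A, o = some u

theorem pickRule_mono (v : V) (o : Option V) : Monotone (pickRule v o) :=
  fun _ _ h ⟨u, hu, ho⟩ => ⟨u, h hu, ho⟩

variable [Fintype V] (G : LTNetwork V)

open Classical in
/-- The activation rule of the threshold process. -/
def thresholdRule (v : V) (x : ℝ) (A : Finset V) : Prop :=
  x ≤ ∑ u ∈ G.inNbrs v ∩ A, (G.prob u v : ℝ)

theorem thresholdRule_mono (v : V) (x : ℝ) : Monotone (G.thresholdRule v x) := by
  classical
  intro A B h hx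
  refine hx.trans (Finset.sum_le_sum_of_subset_of_nonneg ?_ fun _ _ _ => NNReal.coe_nonneg _)
  exact Finset.inter_subset_inter_left h

theorem active_eq_cascade (thr : V → ℝ) (S : Finset V) (i : ℕ) :
    G.active thr S i = cascade (fun v => G.thresholdRule v (thr v)) S i := by
  induction i with
  | zero => rfl
  | succ i ih => rw [active, cascade, ih]; rfl

/-- Both rules activate `v` with probability `∑ p_{uv}` over the active in-neighbours `u`. -/
theorem volume_thresholdRule_eq [MeasurableSpace (Option V)]
    [MeasurableSingletonClass (Option V)] (v : V) (A : Finset V) :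
    (volume : Measure ℝ).restrict (Set.Icc 0 1) {x | G.thresholdRule v x A} =
      (G.pick v).toMeasure {o | pickRule v o A} := by
  classical
  set s : ℝ≥0 := ∑ u ∈ G.inNbrs v ∩ A, G.prob u v with hs
  have hs1 : s ≤ 1 := (Finset.sum_le_sum_of_subset Finset.inter_subset_left).trans
    (G.sum_prob_le_one v)
  have h1 : (volume : Measure ℝ).restrict (Set.Icc 0 1) {x | G.thresholdRule v x A} = s := by
    have hset : {x | G.thresholdRule v x A} = Set.Iic (s : ℝ) := by
      ext x
      simp only [thresholdRule, Set.mem_ofPred_eq, Set.mem_Iic, hs, NNReal.coe_sum]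
    rw [hset, Measure.restrict_apply measurableSet_Iic]
    have : Set.Iic (s : ℝ) ∩ Set.Icc 0 1 = Set.Icc 0 (s : ℝ) := by
      ext x
      simp only [Set.mem_inter_iff, Set.mem_Iic, Set.mem_Icc]
      have : (s : ℝ) ≤ 1 := hs1
      exact ⟨fun h => ⟨h.2.1, h.1⟩, fun h => ⟨h.2, h.1, h.2.trans this⟩⟩
    rw [this, Real.volume_Icc, sub_zero, ENNReal.ofReal_coe_nnreal]
  rw [h1, PMF.toMeasure_apply_fintype, Fintype.sum_option]
  have hnone : (none : Option V) ∉ {o : Option V | pickRule v o A} := by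
    rintro ⟨u, _, h⟩
    cases h
  rw [Set.indicator_of_notMem hnone, zero_add, hs, ENNReal.ofNNReal_finsetSum, Finset.inter_comm,
    ← Finset.sum_ite_mem, ← Finset.sum_subset (Finset.subset_univ A)]
  · refine Finset.sum_congr rfl fun u hu => ?_
    rw [Set.indicator_of_mem (show some u ∈ {o : Option V | pickRule v o A} from ⟨u, hu, rfl⟩)]
    simp only [pick, PMF.ofFintype_apply, Option.elim]
    split_ifs <;> simp
  · intro u _ hu
    refine Set.indicator_of_notMem ?_ _
    rintro ⟨w, hw, h⟩
    cases h
    exact hu hw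

theorem spread_eq [Nonempty V] (S : Finset V) :
    G.spread S = Fintype.card V * hitProb G.rrLaw.toMeasure S := by
  classical
  let _ : MeasurableSpace (Option V) := ⊤
  have _ : DiscreteMeasurableSpace (Option V) := ⟨fun _ => trivial⟩
  have _ : IsProbabilityMeasure ((volume : Measure ℝ).restrict (Set.Icc 0 1)) := ⟨by simp⟩
  set μ : Measure (V → ℝ) := Measure.pi fun _ : V => (volume : Measure ℝ).restrict (Set.Icc 0 1)
    with hμ
  have hmeas (v : V) (A : Finset V) : MeasurableSet {x | G.thresholdRule v x A} := measurableSet_Iic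
  have hev (v : V) :
      MeasurableSet {thr : V → ℝ | ∃ i, v ∈ cascade (fun v => G.thresholdRule v (thr v)) S i} := by
    rw [Set.ofPred_exists]
    exact MeasurableSet.iUnion fun i => measurableSet_mem_cascade hmeas S i v
  have hcard (thr : V → ℝ) : ((G.finalActive thr S).card : ℝ) = ∑ v,
      {thr : V → ℝ | ∃ i, v ∈ cascade (fun v => G.thresholdRule v (thr v)) S i}.indicator
        (fun _ => (1 : ℝ)) thr := by
    simp only [finalActive, active_eq_cascade, Finset.card_filter, Nat.cast_sum, Set.indicator,
      Set.mem_ofPred_eq]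
    refine Finset.sum_congr rfl fun v _ => ?_
    split_ifs <;> simp
  rw [spread, rrLaw, card_mul_hitProb_rr]
  simp only [hcard]
  rw [integral_finsetSum _ fun v _ => (integrable_const _).indicator (hev v)]
  refine Finset.sum_congr rfl fun v _ => ?_
  rw [integral_indicator_const _ (hev v), smul_eq_mul, mul_one, Measure.real, Measure.real,
    measure_exists_mem_cascade_eq (fun v x => G.thresholdRule_mono v x) pickRule_mono hmeas
      (fun _ _ => .of_discrete) G.volume_thresholdRule_eq S v, piPMF_toMeasure]
  congr 2
  ext L
  exact exists_mem_cascade_iff_reachable (fun a b => L b = some a) S v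

end LTNetwork

namespace ICNetwork

variable {V : Type*} [Fintype V] (G : ICNetwork V)

/-- The vertices outside the current front have already activated all their live
out-neighbours, so that it makes no difference if they try again. -/
theorem active_fst_eq_cascade (c : V × V → Bool) (S : Finset V) (i : ℕ) :
    (active c S i).1 = cascade (fun b A => ∃ a ∈ A, c (a, b) = true) S i ∧
      ∀ u ∈ (active c S i).1, u ∉ (active c S i).2 → ∀ v, c (u, v) = true →
        v ∈ (active c S i).1 := by
  classical
  induction i with
  | zero => exact ⟨rfl, fun u hu hu' => absurd hu hu'⟩
  | succ i ih =>
    have hmem (v : V) : v ∈ (active c S (i + 1)).1 ↔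
        v ∈ (active c S i).1 ∨ ∃ a ∈ (active c S i).1, c (a, v) = true := by
      simp only [active, Finset.mem_union, Finset.mem_filter, Finset.mem_univ, true_and]
      constructor
      · rintro (h | ⟨_, u, hu, huv⟩)
        · exact Or.inl h
        · refine Or.inr ⟨u, ?_, huv⟩
          -- the front is part of the active set
          cases i with
          | zero => exact hu
          | succ j => exact Finset.mem_union_right _ hu
      · rintro (h | ⟨u, hu, huv⟩)
        · exact Or.inl h
        · by_cases hv : v ∈ (active c S i).1
          · exact Or.inl hv
          · refine Or.inr ⟨hv, u, ?_, huv⟩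
            by_contra hu'
            exact hv (ih.2 u hu hu' v huv)
    constructor
    · ext v
      rw [hmem, mem_cascade_succ, ih.1]
    · intro u hu hu' v huv
      rw [hmem]
      refine Or.inr ⟨u, ?_, huv⟩
      rcases Finset.mem_union.1 hu with h | h
      · exact h
      · exact absurd h hu'

theorem spread_eq [Nonempty V] (S : Finset V) :
    G.spread S = Fintype.card V * hitProb G.rrLaw.toMeasure S := by
  classical
  rw [spread, rrLaw, card_mul_hitProb_rr _ (fun (c : V × V → Bool) a b => c (a, b) = true)]
  have hcard (c : V × V → Bool) : ((finalActive c S).card : ℝ) = ∑ v,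
      if (∃ u ∈ S, Relation.ReflTransGen (fun a b => c (a, b) = true) u v) then (1 : ℝ) else 0 := by
    simp only [finalActive, (active_fst_eq_cascade c S _).1, Finset.card_filter, Nat.cast_sum,
      exists_mem_cascade_iff_reachable]
    refine Finset.sum_congr rfl fun v _ => ?_
    split_ifs <;> simp
  simp only [hcard, Finset.mul_sum]
  rw [Finset.sum_comm]
  refine Finset.sum_congr rfl fun v _ => ?_
  rw [Measure.real, PMF.toMeasure_apply_fintype, ENNReal.toReal_sum]
  · refine Finset.sum_congr rfl fun c _ => ?_
    by_cases h : ∃ u ∈ S, Relation.ReflTransGen (fun a b => c (a, b) = true) u v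
    · rw [if_pos h, mul_one, Set.indicator_of_mem]
      exact h
    · rw [if_neg h, mul_zero, Set.indicator_of_notMem]
      · rfl
      · exact h
  · intro c _
    refine ne_top_of_le_ne_top ((piPMF G.coin).apply_ne_top c) ?_
    exact Set.indicator_le_self' (fun _ _ => zero_le) c

end ICNetwork

theorem Network.spread_eq {V : Type*} [Fintype V] [Nonempty V] (G : Network V) (S : Finset V) :
    G.spread S = Fintype.card V * hitProb G.rrLaw.toMeasure S := by
  cases G with
  | lt G => exact G.spread_eq S
  | ic G => exact G.spread_eq S

/-! ### The two sampling phases -/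

section Sampling

/-- A bound for a family of events that holds at every fixed index also holds at an independent
random index. -/
theorem measure_random_index_le {Ω X : Type*} [MeasurableSpace Ω] [MeasurableSpace X]
    {P : Measure Ω} [IsProbabilityMeasure P] {N : Ω → ℕ} {Z : Ω → X} (hN : Measurable N)
    (hind : IndepFun N Z P) {B : ℕ → Set X} (hB : ∀ m, MeasurableSet (B m)) {η : ℝ≥0∞}
    (h : ∀ m, P (Z ⁻¹' B m) ≤ η) : P {ω | Z ω ∈ B (N ω)} ≤ η := by
  have hsub : {ω | Z ω ∈ B (N ω)} ⊆ ⋃ m, N ⁻¹' {m} ∩ Z ⁻¹' B m := fun ω hω =>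
    Set.mem_iUnion.2 ⟨N ω, rfl, hω⟩
  have htotal : ∑' m, P (N ⁻¹' {m}) = 1 := by
    rw [← measure_iUnion (fun i j hij => Disjoint.preimage N (Set.disjoint_singleton.2 hij))
      fun m => hN (measurableSet_singleton m), ← Set.preimage_iUnion, Set.iUnion_of_singleton,
      Set.preimage_univ, measure_univ]
  calc P {ω | Z ω ∈ B (N ω)} ≤ ∑' m, P (N ⁻¹' {m} ∩ Z ⁻¹' B m) :=
        (measure_mono hsub).trans (measure_iUnion_le _)
    _ = ∑' m, P (N ⁻¹' {m}) * P (Z ⁻¹' B m) := tsum_congr fun m =>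
        hind.measure_inter_preimage_eq_mul _ _ (measurableSet_singleton m) (hB m)
    _ ≤ ∑' m, P (N ⁻¹' {m}) * η := ENNReal.tsum_le_tsum fun m => mul_le_mul_right (h m) _
    _ = η := by rw [ENNReal.tsum_mul_right, htotal, one_mul]

theorem Upsilon_nonneg {ε δ : ℝ} (hδ : 0 < δ) (hδ2 : δ ≤ 2) : 0 ≤ Upsilon ε δ := by
  have he := Real.exp_one_gt_d9
  have hlog : 0 ≤ Real.log (2 / δ) := Real.log_nonneg (by rwa [le_div_iff₀ hδ, one_mul])
  unfold Upsilon
  have : 0 ≤ Real.exp 1 - 2 := by linarith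
  positivity

/-- The constant `Υ` makes the Chernoff bound equal to `δ / 2`. -/
theorem exp_neg_Upsilon {ε δ : ℝ} (hε : 0 < ε) (hδ : 0 < δ) :
    Real.exp (-(Upsilon ε δ * ε ^ 2 / (4 * (Real.exp 1 - 2)))) = δ / 2 := by
  have hc : Real.exp 1 - 2 ≠ 0 := by linarith [Real.exp_one_gt_d9]
  have : Upsilon ε δ * ε ^ 2 / (4 * (Real.exp 1 - 2)) = Real.log (2 / δ) := by
    rw [Upsilon]; field_simp
  rw [this, ← Real.log_inv, Real.exp_log (by positivity), inv_div]

/-- The sequences of RR sets whose first `M` members estimate the hitting probability of some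
`k`-set badly: too low for the optimal set `T`, or too high for another one. -/
def badSample {V : Type*} (ν : Measure (Finset V)) (k : ℕ) (ε : ℝ) (T : Finset V) (M : ℕ) :
    Set (ℕ → Finset V) :=
  {r | (degree r M T : ℝ) ≤ (1 - ε) * (M * hitProb ν T)} ∪
    {r | ∃ S : Finset V, S.card = k ∧ S ≠ T ∧
      M * hitProb ν S + ε * (M * hitProb ν T) ≤ degree r M S}

/-- On a good sample the greedy seed set is nearly optimal. -/
theorem GreedyOutput.le_hitProb {V : Type*} {ν : Measure (Finset V)}
    {k M : ℕ} {ε : ℝ} (hk : 0 < k) (hM : 0 < M)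
    {S T : Finset V} (hT : T.card = k) {r : ℕ → Finset V} (hr : r ∉ badSample ν k ε T M)
    (hS : GreedyOutput (degree r M) k S) (hST : S ≠ T) :
    (1 - 1 / Real.exp 1 - (2 - 1 / Real.exp 1) * ε) * hitProb ν T ≤ hitProb ν S := by
  simp only [badSample, Set.mem_union, Set.mem_ofPred_eq, not_or, not_exists, not_and, not_le] at hr
  have h1 := hr.1
  have h2 := hr.2 S hS.card_eq hST
  have h3 := hS.one_sub_inv_exp_mul_le hk hT
  have he : 1 / Real.exp 1 < 1 := by
    rw [div_lt_one (Real.exp_pos 1)]; linarith [Real.exp_one_gt_d9]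
  have h4 := mul_le_mul_of_nonneg_left h1.le (sub_nonneg.2 he.le)
  refine le_of_mul_le_mul_left ?_ (Nat.cast_pos.2 hM : (0 : ℝ) < M)
  linarith

variable {V : Type*} [Fintype V] {Ω : Type*} [MeasurableSpace Ω] {P : Measure Ω}
  [IsProbabilityMeasure P] {ν : Measure (Finset V)} {R : ℕ → Ω → Finset V}

/-- The stopping rule does not stop early: if every vertex has probability at most `q`, the first
`Υ / q` sets are unlikely to give some vertex the degree `Υ₁`. -/
theorem measure_exists_Upsilon₁_le_degree (hR : ∀ i, Measurable (R i))
    (hlaw : ∀ i, P.map (R i) = ν) (hind : iIndepFun R P) {ε δ q : ℝ} (hε : 0 < ε)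
    (hε' : ε ≤ 1 / 2) (hδ : 0 < δ) (hδ2 : δ ≤ 2) (hq : 0 < q) (hνq : ∀ u, hitProb ν {u} ≤ q)
    {m : ℕ} (hm : (m : ℝ) ≤ Upsilon ε δ / q) :
    P {ω | ∃ u, Upsilon₁ ε δ ≤ degree (fun i => R i ω) m {u}} ≤
      ENNReal.ofReal (Fintype.card V * (δ / 2)) := by
  have hΥ := Upsilon_nonneg (ε := ε) hδ hδ2
  have hmq : (m : ℝ) * q ≤ Upsilon ε δ := (le_div_iff₀ hq).1 hm
  have single (u : V) : P {ω | Upsilon₁ ε δ ≤ degree (fun i => R i ω) m {u}} ≤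
      ENNReal.ofReal (δ / 2) := by
    rw [← ofReal_measureReal (measure_ne_top _ _)]
    refine ENNReal.ofReal_le_ofReal ?_
    have hA : m * hitProb ν {u} ≤ Upsilon ε δ :=
      (mul_le_mul_of_nonneg_left (hνq u) (Nat.cast_nonneg m)).trans hmq
    rw [← exp_neg_Upsilon hε hδ]
    refine measureReal_le_degree hR hlaw hind m {u} hε.le hε' hA ?_
    rw [Upsilon₁]
    linarith
  rw [Set.ofPred_exists]
  refine (measure_iUnion_fintype_le P _).trans ((Finset.sum_le_sum fun u _ => single u).trans ?_)
  rw [Finset.sum_const, nsmul_eq_mul, Finset.card_univ, ENNReal.ofReal_mul (Nat.cast_nonneg _),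
    ENNReal.ofReal_natCast]

/-- If the first sample is larger than `Υ / q`, the second one is large enough for a union bound
over the `N` candidate seed sets. -/
theorem log_le_secondSize {n kmax m : ℕ} {ε δ q : ℝ} (hε : 0 < ε) (hδ : 0 < δ) (hδ1 : δ < 1)
    (hq : 0 < q) (hn : 0 < n) (hk : kmax ≤ n)
    (hm : Upsilon ε (2 * δ / (3 * n)) / q < m) :
    0 < Real.log (3 * (n.choose kmax : ℝ) / (2 * δ)) ∧
    Real.log (3 * (n.choose kmax : ℝ) / (2 * δ)) ≤
      secondSize n kmax δ m * q * ε ^ 2 / (4 * (Real.exp 1 - 2)) := by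
  have hc : 0 < Real.exp 1 - 2 := by linarith [Real.exp_one_gt_d9]
  have hn1 : (1 : ℝ) ≤ n := Nat.one_le_cast.2 hn
  have hN1 : (1 : ℝ) ≤ n.choose kmax := Nat.one_le_cast.2 (Nat.choose_pos hk)
  set L := Real.log (3 * (n.choose kmax : ℝ) / (2 * δ)) with hL
  have hLpos : 0 < L := Real.log_pos (by rw [lt_div_iff₀ (by positivity)]; linarith)
  have hlog : 0 < Real.log (2 * n / δ) := Real.log_pos (by rw [lt_div_iff₀ hδ]; linarith)
  have hlog' : Real.log (2 * n / δ) ≤ Real.log (2 / (2 * δ / (3 * n))) := by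
    refine Real.log_le_log (by positivity) ?_
    rw [show 2 / (2 * δ / (3 * (n : ℝ))) = 3 * n / δ by field_simp]
    gcongr
    norm_num
  refine ⟨hLpos, ?_⟩
  have h1 : 4 * (Real.exp 1 - 2) * Real.log (2 * n / δ) / ε ^ 2 ≤ m * q := by
    rw [div_lt_iff₀ hq] at hm
    refine le_trans ?_ hm.le
    unfold Upsilon
    gcongr
  have h2 : m * L / Real.log (2 * n / δ) ≤ secondSize n kmax δ m := Nat.le_ceil _
  rw [le_div_iff₀ (by positivity)]
  rw [div_le_iff₀ hlog] at h2
  rw [div_le_iff₀ (by positivity)] at h1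
  have h3 := mul_le_mul_of_nonneg_right h1 hLpos.le
  have h4 := mul_le_mul_of_nonneg_right h2 (show 0 ≤ q * ε ^ 2 by positivity)
  refine le_of_mul_le_mul_right ?_ hlog
  nlinarith

theorem measurableSet_badSample (ν : Measure (Finset V)) (k : ℕ) (ε : ℝ) (T : Finset V) (M : ℕ) :
    MeasurableSet (badSample ν k ε T M) := by
  have hdeg (S : Finset V) : Measurable fun r : ℕ → Finset V => (degree r M S : ℝ) :=
    measurable_degree (R := fun i (r : ℕ → Finset V) => r i) (fun i => measurable_pi_apply i) M S
  refine (measurableSet_le (hdeg T) measurable_const).union ?_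
  simp only [Set.ofPred_exists, Set.ofPred_and]
  refine MeasurableSet.iUnion fun S =>
    (MeasurableSet.const _).inter ((MeasurableSet.const _).inter ?_)
  exact measurableSet_le measurable_const (hdeg S)

/-- The union bound over all `k`-sets. Since the upper tail is not needed for `T` itself, there
is one event per set. -/
theorem measure_badSample_le (hR : ∀ i, Measurable (R i)) (hlaw : ∀ i, P.map (R i) = ν)
    (hind : iIndepFun R P) {k M : ℕ} {ε L : ℝ} (hε : 0 < ε) (hε' : ε ≤ 1 / 2) {T : Finset V}
    (hT : T.card = k) (hopt : ∀ S : Finset V, S.card = k → hitProb ν S ≤ hitProb ν T)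
    (hL : L ≤ M * hitProb ν T * ε ^ 2 / (4 * (Real.exp 1 - 2))) :
    P ((fun ω i => R i ω) ⁻¹' badSample ν k ε T M) ≤
      ENNReal.ofReal ((Fintype.card V).choose k * Real.exp (-L)) := by
  classical
  let E (S : Finset V) : Set Ω :=
    if S = T then {ω | (degree (fun i => R i ω) M T : ℝ) ≤ (1 - ε) * (M * hitProb ν T)}
    else {ω | M * hitProb ν S + ε * (M * hitProb ν T) ≤ degree (fun i => R i ω) M S}
  have hsub : (fun ω i => R i ω) ⁻¹' badSample ν k ε T M ⊆
      ⋃ S ∈ Finset.powersetCard k Finset.univ, E S := by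
    rintro ω (h | ⟨S, hS, hST, h⟩)
    · refine Set.mem_biUnion (Finset.mem_powersetCard_univ.2 hT) ?_
      simp only [E, if_true]
      exact h
    · refine Set.mem_biUnion (Finset.mem_powersetCard_univ.2 hS) ?_
      simp only [E, if_neg hST]
      exact h
  have hE : ∀ S ∈ Finset.powersetCard k (Finset.univ : Finset V),
      P (E S) ≤ ENNReal.ofReal (Real.exp (-L)) := by
    intro S hS
    rw [← ofReal_measureReal (measure_ne_top _ _)]
    refine ENNReal.ofReal_le_ofReal (le_trans ?_ (Real.exp_le_exp.2 (neg_le_neg hL)))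
    by_cases hST : S = T
    · simp only [E, if_pos hST]
      exact measureReal_degree_le hR hlaw hind M T hε.le hε'
    · simp only [E, if_neg hST]
      exact measureReal_le_degree hR hlaw hind M S hε.le hε' (mul_le_mul_of_nonneg_left
        (hopt S (Finset.mem_powersetCard_univ.1 hS)) (Nat.cast_nonneg M)) le_rfl
  refine (measure_mono hsub).trans ((measure_biUnion_finset_le _ _).trans
    ((Finset.sum_le_sum hE).trans ?_))
  rw [Finset.sum_const, nsmul_eq_mul, Finset.card_powersetCard, Finset.card_univ,
    ENNReal.ofReal_mul (Nat.cast_nonneg _), ENNReal.ofReal_natCast]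

end Sampling

end InfluenceMax

open InfluenceMax in
theorem theorem3 {V : Type*} [Fintype V] [Nonempty V] (G : InfluenceMax.Network V)
    (ε δ : ℝ) (hε : 0 < ε) (hδ : 0 < δ) (hδ1 : δ < 1)
    (kmax : ℕ) (hkmax : 2 * kmax ≤ Fintype.card V)
    {Ω : Type*} [MeasurableSpace Ω] (P : Measure Ω) [IsProbabilityMeasure P]
    -- two sequences of random RR sets, the source of the two collections
    (R₁ R₂ : ℕ → Ω → Finset V)
    (hR₁ : ∀ i, Measurable (R₁ i)) (hR₂ : ∀ i, Measurable (R₂ i))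
    (hlaw₁ : ∀ i, P.map (R₁ i) = G.rrLaw.toMeasure)
    (hlaw₂ : ∀ i, P.map (R₂ i) = G.rrLaw.toMeasure)
    (hind₁ : iIndepFun R₁ P) (hind₂ : iIndepFun R₂ P)
    -- the random size of the first collection; the second sequence is independent of the
    -- first one and of this size
    (M₁ : Ω → ℕ) (hM₁ : Measurable M₁)
    (hind : IndepFun (fun ω => ((fun i => R₁ i ω), M₁ ω)) (fun ω i => R₂ i ω) P)
    -- the invariant on the largest degree in the first collection
    (hinv : ∀ᵐ ω ∂P, InfluenceMax.maxDegree (fun i => R₁ i ω) (M₁ ω) =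
      ⌈InfluenceMax.Upsilon₁ ε (2 * δ / (3 * Fintype.card V))⌉₊)
    -- the query, and the seed set that greedy returns on the second collection
    (k : ℕ) (hk : k ≤ kmax) (Sk : Ω → Finset V)
    (hSk : ∀ᵐ ω ∂P, InfluenceMax.GreedyOutput
      (InfluenceMax.degree (fun i => R₂ i ω)
        (InfluenceMax.secondSize (Fintype.card V) kmax δ (M₁ ω))) k (Sk ω))
    (Sopt : Finset V) (hSopt : InfluenceMax.IsOptimalSeedSet G.spread k Sopt) :
    1 - δ ≤ P.real {ω | (1 - 1 / Real.exp 1 - (2 - 1 / Real.exp 1) * ε) * G.spread Sopt ≤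
      G.spread (Sk ω)} := by
  classical
  set n := Fintype.card V with hn
  have hn0 : 0 < n := Fintype.card_pos
  have hnR : (0 : ℝ) < n := Nat.cast_pos.2 hn0
  have hn1 : (1 : ℝ) ≤ n := Nat.one_le_cast.2 hn0
  set ν := G.rrLaw.toMeasure with hν
  set c := 1 - 1 / Real.exp 1 - (2 - 1 / Real.exp 1) * ε with hc
  set q := hitProb ν Sopt with hq
  obtain ⟨hcard, hmax⟩ := hSopt
  have hopt : ∀ S : Finset V, S.card = k → hitProb ν S ≤ q := fun S hS => by
    have := hmax S hS
    rw [G.spread_eq, G.spread_eq] at this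
    exact le_of_mul_le_mul_left this hnR
  have hx0 : 0 < 1 / Real.exp 1 := by positivity
  have hx1 : 1 / Real.exp 1 < 1 := by
    rw [div_lt_one (Real.exp_pos 1)]; linarith [Real.exp_one_gt_d9]
  have hc1 : c ≤ 1 := by nlinarith
  have hq0 : 0 ≤ q := hitProb_nonneg ν Sopt
  set good := {ω | c * G.spread Sopt ≤ G.spread (Sk ω)} with hgood
  have mem_good {ω : Ω} (h : c * q ≤ hitProb ν (Sk ω)) : ω ∈ good := by
    change c * G.spread Sopt ≤ G.spread (Sk ω)
    rw [G.spread_eq, G.spread_eq, mul_left_comm]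
    exact mul_le_mul_of_nonneg_left h hnR.le
  have mem_good_of_eq {ω : Ω} (h : Sk ω = Sopt) : ω ∈ good :=
    mem_good (by rw [h]; exact mul_le_of_le_one_left hq0 hc1)
  -- `good` need not be measurable, hence the outer measure of its complement is bounded
  suffices hbad : P goodᶜ ≤ ENNReal.ofReal δ by
    have h1 : (1 : ℝ) ≤ P.real good + P.real goodᶜ := by
      rw [← probReal_univ (μ := P), ← Set.union_compl_self good]
      exact measureReal_union_le _ _
    have h2 : P.real goodᶜ ≤ δ := ENNReal.toReal_le_of_le_ofReal hδ.le hbad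
    linarith
  by_cases htriv : 0 < c ∧ 0 < q ∧ 0 < k
  swap
  · -- the guarantee is vacuous, or there is only one seed set
    have : P goodᶜ = 0 := by
      filter_upwards [hSk] with ω hω
      by_contra hmem
      apply hmem
      by_cases hk0 : k = 0
      · apply mem_good_of_eq
        rw [Finset.card_eq_zero.1 (hω.card_eq.trans hk0), Finset.card_eq_zero.1 (hcard.trans hk0)]
      · apply mem_good
        have hcq : c * q ≤ 0 := by
          by_cases hc0 : 0 < c
          · have : q = 0 :=
              le_antisymm (not_lt.1 fun h => htriv ⟨hc0, h, Nat.pos_of_ne_zero hk0⟩) hq0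
            rw [this, mul_zero]
          · exact mul_nonpos_of_nonpos_of_nonneg (not_lt.1 hc0) hq0
        exact hcq.trans (hitProb_nonneg ν _)
    rw [this]
    exact zero_le
  obtain ⟨hc0, hq0, hk0⟩ := htriv
  have hε' : ε ≤ 1 / 2 := by nlinarith
  set δ' := 2 * δ / (3 * (n : ℝ)) with hδ'
  have hδ'0 : 0 < δ' := by positivity
  have hδ'2 : δ' ≤ 2 := by rw [hδ', div_le_iff₀ (by positivity)]; linarith
  have hkn : kmax ≤ n := by lia
  have hvertex (u : V) : hitProb ν {u} ≤ q := by
    obtain ⟨T, hT, hTk⟩ := Finset.exists_superset_card_eq (s := {u}) (n := k)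
      (by rw [Finset.card_singleton]; exact hk0) (hk.trans hkn)
    exact (hitProb_mono ν hT).trans (hopt T hTk)
  set m₀ := ⌊Upsilon ε δ' / q⌋₊ with hm₀
  have hm₀le : (m₀ : ℝ) ≤ Upsilon ε δ' / q :=
    Nat.floor_le (div_nonneg (Upsilon_nonneg hδ'0 hδ'2) hq0.le)
  have hsmall :=
    measure_exists_Upsilon₁_le_degree hR₁ hlaw₁ hind₁ hε hε' hδ'0 hδ'2 hq0 hvertex hm₀le
  set N : ℝ := (n.choose kmax : ℝ) with hN
  have hN0 : 0 < N := Nat.cast_pos.2 (Nat.choose_pos hkn)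
  set B : ℕ → Set (ℕ → Finset V) := fun m =>
    if m₀ < m then badSample ν k ε Sopt (secondSize n kmax δ m) else ∅ with hB
  have hlarge {m : ℕ} (hm : m₀ < m) := log_le_secondSize (kmax := kmax) hε hδ hδ1 hq0 hn0 hkn
    ((Nat.floor_lt' (Nat.ne_zero_of_lt hm)).1 hm)
  have hBmeas (m : ℕ) : MeasurableSet (B m) := by
    simp only [hB]
    split_ifs
    · exact measurableSet_badSample _ _ _ _ _
    · exact .empty
  have hBle (m : ℕ) : P ((fun ω i => R₂ i ω) ⁻¹' B m) ≤ ENNReal.ofReal (2 * δ / 3) := by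
    simp only [hB]
    split_ifs with hm
    · refine (measure_badSample_le hR₂ hlaw₂ hind₂ hε hε' hcard hopt (hlarge hm).2).trans
        (ENNReal.ofReal_le_ofReal ?_)
      rw [← Real.log_inv, Real.exp_log (by positivity), inv_div]
      calc ((n.choose k : ℕ) : ℝ) * (2 * δ / (3 * N)) ≤ N * (2 * δ / (3 * N)) := by
            refine mul_le_mul_of_nonneg_right (Nat.cast_le.2 ?_) (by positivity)
            exact choose_le_choose_of_le_half hk hkmax
        _ = 2 * δ / 3 := by field_simp
    · simp
  have hsecond := measure_random_index_le hM₁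
    (hind.comp measurable_snd measurable_id : IndepFun M₁ (fun ω i => R₂ i ω) P) hBmeas hBle
  have hcover : P goodᶜ ≤ P ({ω | ∃ u, Upsilon₁ ε δ' ≤ degree (fun i => R₁ i ω) m₀ {u}} ∪
      {ω | (fun i => R₂ i ω) ∈ B (M₁ ω)}) := by
    refine measure_mono_ae ?_
    filter_upwards [hinv, hSk] with ω hω hωS hωbad
    by_cases hm : m₀ < M₁ ω
    · right
      by_contra hnot
      have hnot' : (fun i => R₂ i ω) ∉ badSample ν k ε Sopt (secondSize n kmax δ (M₁ ω)) := by
        intro h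
        apply hnot
        change _ ∈ B (M₁ ω)
        simp only [hB, if_pos hm]
        exact h
      obtain ⟨hLpos, hLle⟩ := hlarge hm
      have hM : 0 < secondSize n kmax δ (M₁ ω) := by
        by_contra h0
        rw [Nat.eq_zero_of_not_pos h0] at hLle
        simp only [Nat.cast_zero, zero_mul, zero_div] at hLle
        exact absurd hLle (not_le.2 hLpos)
      by_cases hS : Sk ω = Sopt
      · exact hωbad (mem_good_of_eq hS)
      · exact hωbad (mem_good (hωS.le_hitProb hk0 hM hcard hnot' hS))
    · left
      obtain ⟨u, _, hu⟩ := Finset.exists_mem_eq_sup (Finset.univ : Finset V) Finset.univ_nonempty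
        fun u => degree (fun i => R₁ i ω) (M₁ ω) {u}
      refine ⟨u, (Nat.le_ceil _).trans (Nat.cast_le.2 ?_)⟩
      rw [← hω, maxDegree, hu]
      exact degree_mono_left _ _ (not_lt.1 hm)
  calc P goodᶜ ≤ ENNReal.ofReal (n * (δ' / 2)) + ENNReal.ofReal (2 * δ / 3) :=
        hcover.trans ((measure_union_le _ _).trans (add_le_add hsmall hsecond))
    _ = ENNReal.ofReal δ := by
        rw [← ENNReal.ofReal_add (by positivity) (by positivity)]
        congr 1
        rw [hδ']
        field_simp
        ring
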